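/- **Theorem.** $\mathrm{NWTL}^+ + \mathcal{W}$ is exponentially more succinct than $\mathrm{NWTL}^+$: there are formulas $\varphi_n$ ($n\ge 1$) of $\mathrm{NWTL}^+ + \mathcal{W}$, where $\varphi_n$ uses the atomic propositions $AP_n=\{a_0,\dots,a_n\}$, such that 1. $\varphi_n$ has size $O(n)$; 2. for every $n\ge1$ there is an $\mathrm{NWTL}^+$ formula over $AP_n$ that is equivalent to $\varphi_n$ (at every position of every finite nested word and every nested $\omega$-word over $2^{AP_n}$); 3. every such formula has size $2^{\Omega(n)}$; indeed there are $c>0$ and $n_0$ such that for all $n\ge n_0$, every $\mathrm{NWTL}^+$ formula $\psi$ over $AP_n$ that is true at the first position of exactly the same nested $\omega$-words over $2^{AP_n}$ as $\varphi_n$ has size at least $2^{cn}$. *Definitions.* A nested word over $2^{AP}$ is a finite word $w$ (positions $1,\dots,n$) or an $\omega$-word (positions $1,2,\dots$) over $2^{AP}$ with a matching: a binary relation $\mu$ and sets $\mathtt{call}$, $\mathtt{ret}$ of positions such that $\mu(i,j)$ implies $\mathtt{call}(i)$, $\mathtt{ret}(j)$ and $i<j$; each position is matched to at most one partner in each direction;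 and if $i\le j$, $\mathtt{call}(i)$ and $\mathtt{ret}(j)$, then $\mu(i,k)$ or $\mu(k,j)$ for some $i\le k\le j$. Formulas of $\mathrm{NWTL}^+$ are built from $\top$, $a\in AP$, $\mathtt{call}$, $\mathtt{ret}$ by $\neg$, $\vee$, next and previous along the successor relation and along $\mu$, and until and since over summary paths ($\mathbf U^\sigma,\mathbf S^\sigma$), linear paths ($\mathbf U,\mathbf S$), call paths ($\mathbf U^c,\mathbf S^c$) and abstract paths ($\mathbf U^a,\mathbf S^a$). Here a path from $i$ to $j$ is a sequence $i=i_0<\dots<i_k=j$, $k\ge0$, which is: linear if $i_{p+1}=i_p+1$; summary if $i_{p+1}$ is the matching return of $i_p$ when that return exists and is $\le j$, and $i_{p+1}=i_p+1$ otherwise; abstract if $i_{p+1}$ is the matching return of $i_p$, or $i_p$ is not a call and $i_{p+1}=i_p+1$ is not a matched return; a call path if $i_p$ is the greatest matched call $<i_{p+1}$ whose return is $>i_{p+1}$. For each kind of path, $\varphi\,\mathbf U\,\psi$ holds at $i$ if there is a path $i=i_0<\dots<i_k=j$ with $\psi$ true at $j$ and $\varphi$ true at $i_p$ for $0\le p<k$;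 $\varphi\,\mathbf S\,\psi$ holds at $i$ if there is a path $j=i_0<\dots<i_k=i$ with $\psi$ true at $j$ and $\varphi$ true at $i_p$ for $0<p\le k$. $\mathrm{NWTL}^+ + \mathcal W$ has in addition the operator $\mathcal W$: $\mathcal W\varphi$ holds at $i$ if $i$ is a call and $\varphi$ holds at $i$ in the subword from $i$ to its matching return, or from $i$ on if $i$ has none. The size of a formula is the number of occurrences of operators and atomic formulas in it. -/

import Mathlib

/-- A nested word over the alphabet `Set AP` whose positions form an interval `dom` of `ℕ`:
`label i` is the set of atomic propositions true at position `i` (its values outside `dom` are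
irrelevant), and `(M, call, ret)` is a matching on `dom`. -/
structure NestedWord (AP : Type*) where
  dom : Set ℕ
  ordConnected : dom.OrdConnected
  label : ℕ → Set AP
  M : ℕ → ℕ → Prop
  call : ℕ → Prop
  ret : ℕ → Prop
  call_mem : ∀ i, call i → i ∈ dom
  ret_mem : ∀ i, ret i → i ∈ dom
  M_call : ∀ i j, M i j → call i
  M_ret : ∀ i j, M i j → ret j
  M_lt : ∀ i j, M i j → i < j
  M_right_unique : ∀ i j j', M i j → M i j' → j = j'
  M_left_unique : ∀ i i' j, M i j → M i' j → i = i'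
  nested : ∀ i j, i ≤ j → call i → ret j → ∃ k, i ≤ k ∧ k ≤ j ∧ (M i k ∨ M k j)

namespace NestedWord

variable {AP : Type*}

/-- A finite nested word of some length `n ≥ 0`, with positions `1, …, n`. -/
def IsFinite (w : NestedWord AP) : Prop := ∃ n : ℕ, w.dom = Set.Icc 1 n

/-- A nested `ω`-word, with positions `1, 2, 3, …`. -/
def IsOmega (w : NestedWord AP) : Prop := w.dom = Set.Ici 1

/-- The substructure of `w` induced by the positions in the interval `S`;
positions keep their names. -/
def restrict (w : NestedWord AP) (S : Set ℕ) (hS : S.OrdConnected) : NestedWord AP where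
  dom := w.dom ∩ S
  ordConnected := w.ordConnected.inter hS
  label := w.label
  M i j := w.M i j ∧ i ∈ S ∧ j ∈ S
  call i := w.call i ∧ i ∈ S
  ret i := w.ret i ∧ i ∈ S
  call_mem i h := ⟨w.call_mem i h.1, h.2⟩
  ret_mem i h := ⟨w.ret_mem i h.1, h.2⟩
  M_call i j h := ⟨w.M_call i j h.1, h.2.1⟩
  M_ret i j h := ⟨w.M_ret i j h.1, h.2.2⟩
  M_lt i j h := w.M_lt i j h.1
  M_right_unique i j j' h h' := w.M_right_unique i j j' h.1 h'.1
  M_left_unique i i' j h h' := w.M_left_unique i i' j h.1 h'.1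
  nested i j hij hi hj := by
    obtain ⟨k, hik, hkj, hk⟩ := w.nested i j hij hi.1 hj.1
    have hkS : k ∈ S := hS.out hi.2 hj.2 ⟨hik, hkj⟩
    exact ⟨k, hik, hkj, hk.imp (fun h => ⟨h, hi.2, hkS⟩) (fun h => ⟨h, hkS, hj.2⟩)⟩

/-- The subword `w[i, j]`. -/
def sub (w : NestedWord AP) (i j : ℕ) : NestedWord AP :=
  w.restrict (Set.Icc i j) Set.ordConnected_Icc

/-- The subword of `w` consisting of all positions from `i` on. -/
def subFrom (w : NestedWord AP) (i : ℕ) : NestedWord AP :=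
  w.restrict (Set.Ici i) Set.ordConnected_Ici

def IsMatchedCall (w : NestedWord AP) (i : ℕ) : Prop := ∃ j, w.M i j

def IsMatchedReturn (w : NestedWord AP) (j : ℕ) : Prop := ∃ i, w.M i j

/-- `c = 𝒞(i)`: `c` is the greatest matched call before `i` whose matching return is after `i`. -/
def IsInnermostCall (w : NestedWord AP) (c i : ℕ) : Prop :=
  IsGreatest {c' | c' < i ∧ ∃ r, w.M c' r ∧ i < r} c

end NestedWord

/-- The four kinds of paths. -/
inductive PathKind
  | summary
  | linear
  | callPath
  | abstr

/-- `PathStep w κ j a b`: on a path of kind `κ` with last position `j`, the position `a` may be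
followed by `b`. Only summary paths look at `j`. -/
def PathStep {AP : Type*} (w : NestedWord AP) : PathKind → ℕ → ℕ → ℕ → Prop
  | .summary, j, a, b => (w.M a b ∧ b ≤ j) ∨ ((¬ ∃ r, w.M a r ∧ r ≤ j) ∧ b = a + 1)
  | .linear, _, a, b => b = a + 1
  | .callPath, _, a, b => w.IsInnermostCall a b
  | .abstr, _, a, b => w.M a b ∨ (¬ w.call a ∧ b = a + 1 ∧ ¬ w.IsMatchedReturn b)

/-- `s 0 < s 1 < … < s k` is a path of kind `κ` from `i` to `j`. -/
def IsPath {AP : Type*} (w : NestedWord AP) (κ : PathKind) (i j k : ℕ) (s : ℕ → ℕ) : Prop :=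
  i ∈ w.dom ∧ j ∈ w.dom ∧ s 0 = i ∧ s k = j ∧
    ∀ p < k, s p < s (p + 1) ∧ PathStep w κ j (s p) (s (p + 1))

/-- Formulas of `NWTL⁺ + 𝒲`: until and since are indexed by the kind of path. -/
inductive NWFormula (AP : Type*)
  | top : NWFormula AP
  | atom : AP → NWFormula AP
  | call : NWFormula AP
  | ret : NWFormula AP
  | neg : NWFormula AP → NWFormula AP
  | or : NWFormula AP → NWFormula AP → NWFormula AP
  | next : NWFormula AP → NWFormula AP
  | nextM : NWFormula AP → NWFormula AP
  | prev : NWFormula AP → NWFormula AP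
  | prevM : NWFormula AP → NWFormula AP
  | untl : PathKind → NWFormula AP → NWFormula AP → NWFormula AP
  | since : PathKind → NWFormula AP → NWFormula AP → NWFormula AP
  | within : NWFormula AP → NWFormula AP

namespace NWFormula

variable {AP : Type*}

/-- Formulas of `NWTL⁺`: those without the within operator. -/
def IsNWTLPlus : NWFormula AP → Prop
  | top => True
  | atom _ => True
  | call => True
  | ret => True
  | neg φ => φ.IsNWTLPlus
  | or φ ψ => φ.IsNWTLPlus ∧ ψ.IsNWTLPlus
  | next φ => φ.IsNWTLPlus
  | nextM φ => φ.IsNWTLPlus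
  | prev φ => φ.IsNWTLPlus
  | prevM φ => φ.IsNWTLPlus
  | untl _ φ ψ => φ.IsNWTLPlus ∧ ψ.IsNWTLPlus
  | since _ φ ψ => φ.IsNWTLPlus ∧ ψ.IsNWTLPlus
  | within _ => False

/-- The size of a formula: the number of occurrences of operators and atomic formulas. -/
def size : NWFormula AP → ℕ
  | top => 1
  | atom _ => 1
  | call => 1
  | ret => 1
  | neg φ => φ.size + 1
  | or φ ψ => φ.size + ψ.size + 1
  | next φ => φ.size + 1
  | nextM φ => φ.size + 1
  | prev φ => φ.size + 1
  | prevM φ => φ.size + 1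
  | untl _ φ ψ => φ.size + ψ.size + 1
  | since _ φ ψ => φ.size + ψ.size + 1
  | within φ => φ.size + 1

/-- `φ.Sat w i` is `(w, i) ⊨ φ`, for positions `i` of `w`. -/
def Sat : NWFormula AP → NestedWord AP → ℕ → Prop
  | top, _, _ => True
  | atom a, w, i => a ∈ w.label i
  | call, w, i => w.call i
  | ret, w, i => w.ret i
  | neg φ, w, i => ¬ φ.Sat w i
  | or φ ψ, w, i => φ.Sat w i ∨ ψ.Sat w i
  | next φ, w, i => i + 1 ∈ w.dom ∧ φ.Sat w (i + 1)
  | nextM φ, w, i => ∃ j, w.M i j ∧ φ.Sat w j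
  | prev φ, w, i => ∃ j ∈ w.dom, j + 1 = i ∧ φ.Sat w j
  | prevM φ, w, i => ∃ j, w.M j i ∧ φ.Sat w j
  | untl κ φ ψ, w, i => ∃ (j k : ℕ) (s : ℕ → ℕ), IsPath w κ i j k s ∧ ψ.Sat w j ∧
      ∀ p, p < k → φ.Sat w (s p)
  | since κ φ ψ, w, i => ∃ (j k : ℕ) (s : ℕ → ℕ), IsPath w κ j i k s ∧ ψ.Sat w j ∧
      ∀ p, 0 < p → p ≤ k → φ.Sat w (s p)
  | within φ, w, i => w.call i ∧
      ((∃ j, w.M i j ∧ φ.Sat (w.sub i j) i) ∨ (¬ w.IsMatchedCall i ∧ φ.Sat (w.subFrom i) i))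

/-- Equivalence at every position of every nested word, finite or infinite. -/
def Equivalent (φ ψ : NWFormula AP) : Prop :=
  ∀ w : NestedWord AP, (w.IsFinite ∨ w.IsOmega) → ∀ i ∈ w.dom, (φ.Sat w i ↔ ψ.Sat w i)

/-- `φ` and `ψ` have the same nested `ω`-words as models, where `w` is a model
of a formula if the formula is true at the first position of `w`. -/
def SameOmegaModels (φ ψ : NWFormula AP) : Prop :=
  ∀ w : NestedWord AP, w.IsOmega → (φ.Sat w 1 ↔ ψ.Sat w 1)

end NWFormula

/-! The witness `noConflict n` forbids a pending call `p` with a later position that differs from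
`p` on `a₀` and agrees with it on `a₁, …, aₙ`. At a pending call, `within` cuts off everything
before `p`. Inside its scope `p` is then the only position without a predecessor, so past operators
can consult its label and one subformula per proposition suffices. Without `within` the label of `p`
can still be remembered by listing all conflicting pairs of labels (`noConflictPlus`), at
exponential cost.

For the lower bound, restrict to words of pending calls only. There the matching is empty and
`NWTL⁺` collapses to linear temporal logic with past. The truth values of the subformulas of `ψ` at
a position `N` are all that `ψ` can carry across `N`: words agreeing on them can be glued there
(`sat_glue`). Each of the `2 ^ 2 ^ n` Boolean functions on `n`-bit addresses gives a conflict-free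
periodic word, while gluing the words of two different functions after one period creates a conflict
(`exists_labelConflict_glue`). Hence these words have distinct truth vectors at `2 ^ n`, so `2 ^ 2 ^
n ≤ 2 ^ ψ.size`. -/

/-! ### Path kinds whose steps are exactly the successor, or that have no steps -/

theorem eq_add_of_isPath {AP : Type*} {w : NestedWord AP} {κ : PathKind} {i j k : ℕ} {s : ℕ → ℕ}
    (hκ : ∀ j a b, PathStep w κ j a b ↔ b = a + 1) (h : IsPath w κ i j k s) :
    j = i + k ∧ ∀ p ≤ k, s p = i + p := by
  obtain ⟨-, -, h0, hk, hs⟩ := h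
  have key : ∀ p ≤ k, s p = i + p := by
    intro p
    induction p with
    | zero => intro _; simpa using h0
    | succ p ih =>
      intro hp
      rw [(hκ _ _ _).1 (hs p (by omega)).2, ih (by omega)]
      omega
  exact ⟨by rw [← hk, key k le_rfl], key⟩

theorem isPath_of_le {AP : Type*} {w : NestedWord AP} {κ : PathKind} {i j : ℕ}
    (hκ : ∀ j a b, PathStep w κ j a b ↔ b = a + 1) (hi : i ∈ w.dom) (hj : j ∈ w.dom)
    (hij : i ≤ j) : IsPath w κ i j (j - i) (fun p => i + p) :=
  ⟨hi, hj, rfl, by simp only; omega, fun p _ => ⟨by simp only; omega, (hκ _ _ _).2 rfl⟩⟩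

theorem eq_of_isPath_of_not_step {AP : Type*} {w : NestedWord AP} {κ : PathKind} {i j k : ℕ} {s : ℕ → ℕ}
    (hκ : ∀ j, ∀ a ∈ w.dom, ∀ b, ¬ PathStep w κ j a b) (h : IsPath w κ i j k s) : k = 0 ∧ j = i := by
  obtain ⟨hi, -, h0, hk, hs⟩ := h
  have : k = 0 := by
    by_contra hne
    exact hκ _ _ (h0 ▸ hi) _ (hs 0 (by omega)).2
  subst this
  exact ⟨rfl, by rw [← hk, h0]⟩

namespace NWFormula

variable {AP : Type*}

/-- Covers linear paths in every word, and summary paths in words of pending calls. -/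
theorem sat_untl_of_step_iff_succ {w : NestedWord AP} {κ : PathKind}
    (hκ : ∀ j a b, PathStep w κ j a b ↔ b = a + 1) (φ ψ : NWFormula AP) (i : ℕ) :
    (untl κ φ ψ).Sat w i ↔ i ∈ w.dom ∧ ∃ j ∈ w.dom, i ≤ j ∧ ψ.Sat w j ∧
      ∀ p, i ≤ p → p < j → φ.Sat w p := by
  constructor
  · rintro ⟨j, k, s, hs, hj, hp⟩
    obtain ⟨rfl, hs'⟩ := eq_add_of_isPath hκ hs
    refine ⟨hs.1, _, hs.2.1, by omega, hj, fun p h1 h2 => ?_⟩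
    have := hp (p - i) (by omega)
    rwa [hs' _ (by omega), show i + (p - i) = p by omega] at this
  · rintro ⟨hi, j, hj, hij, hψ, hφ⟩
    exact ⟨j, _, _, isPath_of_le hκ hi hj hij, hψ, fun p hp => hφ _ (by omega) (by omega)⟩

theorem sat_since_of_step_iff_succ {w : NestedWord AP} {κ : PathKind}
    (hκ : ∀ j a b, PathStep w κ j a b ↔ b = a + 1) (φ ψ : NWFormula AP) (i : ℕ) :
    (since κ φ ψ).Sat w i ↔ i ∈ w.dom ∧ ∃ j ∈ w.dom, j ≤ i ∧ ψ.Sat w j ∧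
      ∀ p, j < p → p ≤ i → φ.Sat w p := by
  constructor
  · rintro ⟨j, k, s, hs, hj, hp⟩
    obtain ⟨rfl, hs'⟩ := eq_add_of_isPath hκ hs
    refine ⟨hs.2.1, _, hs.1, by omega, hj, fun p h1 h2 => ?_⟩
    have := hp (p - j) (by omega) (by omega)
    rwa [hs' _ (by omega), show j + (p - j) = p by omega] at this
  · rintro ⟨hi, j, hj, hij, hψ, hφ⟩
    exact ⟨j, _, _, isPath_of_le hκ hj hi hij, hψ, fun p hp hp' => hφ _ (by omega) (by omega)⟩

/-- Covers call paths and abstract paths in words of pending calls, where only the path of length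
zero exists. -/
theorem sat_untl_of_not_step {w : NestedWord AP} {κ : PathKind}
    (hκ : ∀ j, ∀ a ∈ w.dom, ∀ b, ¬ PathStep w κ j a b) (φ ψ : NWFormula AP) (i : ℕ) :
    (untl κ φ ψ).Sat w i ↔ i ∈ w.dom ∧ ψ.Sat w i := by
  constructor
  · rintro ⟨j, k, s, hs, hj, -⟩
    obtain ⟨rfl, rfl⟩ := eq_of_isPath_of_not_step hκ hs
    exact ⟨hs.1, hj⟩
  · rintro ⟨hi, hψ⟩
    exact ⟨i, 0, fun _ => i, ⟨hi, hi, rfl, rfl, by simp⟩, hψ, by simp⟩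

theorem sat_since_of_not_step {w : NestedWord AP} {κ : PathKind}
    (hκ : ∀ j, ∀ a ∈ w.dom, ∀ b, ¬ PathStep w κ j a b) (φ ψ : NWFormula AP) (i : ℕ) :
    (since κ φ ψ).Sat w i ↔ i ∈ w.dom ∧ ψ.Sat w i := by
  constructor
  · rintro ⟨j, k, s, hs, hj, -⟩
    obtain ⟨rfl, rfl⟩ := eq_of_isPath_of_not_step hκ hs
    exact ⟨hs.1, hj⟩
  · rintro ⟨hi, hψ⟩
    exact ⟨i, 0, fun _ => i, ⟨hi, hi, rfl, rfl, by simp⟩, hψ, fun p h h' => by omega⟩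

/-! ### Derived connectives -/

def and (φ ψ : NWFormula AP) : NWFormula AP := neg (or (neg φ) (neg ψ))

/-- Some position from here on satisfies `φ`. -/
def eventually (φ : NWFormula AP) : NWFormula AP := untl .linear top φ

/-- Some position up to here satisfies `φ`. -/
def once (φ : NWFormula AP) : NWFormula AP := since .linear top φ

def bigOr (l : List (NWFormula AP)) : NWFormula AP := l.foldr or (neg top)

def bigAnd (l : List (NWFormula AP)) : NWFormula AP := l.foldr and top

@[simp] theorem sat_and (φ ψ : NWFormula AP) (w : NestedWord AP) (i : ℕ) :
    (and φ ψ).Sat w i ↔ φ.Sat w i ∧ ψ.Sat w i := by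
  simp [and, Sat]

@[simp] theorem sat_eventually (φ : NWFormula AP) (w : NestedWord AP) (i : ℕ) :
    (eventually φ).Sat w i ↔ i ∈ w.dom ∧ ∃ j ∈ w.dom, i ≤ j ∧ φ.Sat w j := by
  rw [eventually, sat_untl_of_step_iff_succ (fun _ _ _ => Iff.rfl)]
  simp [Sat]

@[simp] theorem sat_once (φ : NWFormula AP) (w : NestedWord AP) (i : ℕ) :
    (once φ).Sat w i ↔ i ∈ w.dom ∧ ∃ j ∈ w.dom, j ≤ i ∧ φ.Sat w j := by
  rw [once, sat_since_of_step_iff_succ (fun _ _ _ => Iff.rfl)]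
  simp [Sat]

@[simp] theorem sat_bigOr (l : List (NWFormula AP)) (w : NestedWord AP) (i : ℕ) :
    (bigOr l).Sat w i ↔ ∃ φ ∈ l, φ.Sat w i := by
  induction l with
  | nil => simp [bigOr, Sat]
  | cons φ l ih =>
    simp only [bigOr, List.foldr_cons, Sat, List.mem_cons, exists_eq_or_imp] at ih ⊢
    rw [ih]

@[simp] theorem sat_bigAnd (l : List (NWFormula AP)) (w : NestedWord AP) (i : ℕ) :
    (bigAnd l).Sat w i ↔ ∀ φ ∈ l, φ.Sat w i := by
  induction l with
  | nil => simp [bigAnd, Sat]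
  | cons φ l ih =>
    simp only [bigAnd, List.foldr_cons, sat_and, List.mem_cons, forall_eq_or_imp] at ih ⊢
    rw [ih]

theorem isNWTLPlus_bigOr {l : List (NWFormula AP)} (h : ∀ φ ∈ l, φ.IsNWTLPlus) :
    (bigOr l).IsNWTLPlus := by
  induction l with
  | nil => trivial
  | cons φ l ih =>
    exact ⟨h φ List.mem_cons_self, ih fun χ hχ => h χ (List.mem_cons_of_mem _ hχ)⟩

theorem isNWTLPlus_bigAnd {l : List (NWFormula AP)} (h : ∀ φ ∈ l, φ.IsNWTLPlus) :
    (bigAnd l).IsNWTLPlus := by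
  induction l with
  | nil => trivial
  | cons φ l ih =>
    exact ⟨h φ List.mem_cons_self, ih fun χ hχ => h χ (List.mem_cons_of_mem _ hχ)⟩

theorem size_bigOr {l : List (NWFormula AP)} {c : ℕ} (h : ∀ φ ∈ l, φ.size ≤ c) :
    (bigOr l).size ≤ (c + 1) * l.length + 2 := by
  induction l with
  | nil => simp [bigOr, size]
  | cons φ l ih =>
    have h1 := h φ List.mem_cons_self
    have h2 := ih fun χ hχ => h χ (List.mem_cons_of_mem _ hχ)
    have h3 : (bigOr (φ :: l)).size = φ.size + (bigOr l).size + 1 := rfl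
    rw [h3, List.length_cons, Nat.mul_succ]
    omega

/-! ### The succinct formulas -/

/-- The current position and the first position of the word disagree on `a`. -/
def disagree (a : AP) : NWFormula AP :=
  or (and (atom a) (neg (once (and (neg (prev top)) (atom a)))))
    (and (neg (atom a)) (once (and (neg (prev top)) (atom a))))

/-- Some position disagrees with the first one on `a₀` but agrees with it on `a₁, …, aₙ`. -/
def conflict (n : ℕ) : NWFormula (Fin (n + 1)) :=
  eventually (and (disagree 0)
    (neg (bigOr ((List.finRange n).map fun k => disagree k.succ))))

/-- No position from a pending call `p` on is in conflict with `p`. -/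
def noConflict (n : ℕ) : NWFormula (Fin (n + 1)) :=
  neg (eventually (and (neg (nextM top)) (within (conflict n))))

theorem size_noConflict_le {n : ℕ} (hn : 1 ≤ n) : (noConflict n).size ≤ 100 * n := by
  have h1 : ∀ a : Fin (n + 1), (disagree a).size = 33 := fun a => rfl
  have h2 := size_bigOr (l := (List.finRange n).map fun k => disagree k.succ) (c := 33) (by simp [h1])
  simp only [List.length_map, List.length_finRange] at h2
  -- The total is at most `34 * n + 53`; the constant 100 leaves slack for `n ≥ 1`.
  simp only [noConflict, conflict, eventually, and, size, h1]
  omega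

end NWFormula

/-! ### Semantics of the succinct formulas -/

/-- The labels `A` and `B` differ on `a₀` and agree on `a₁, …, aₙ`. -/
def LabelConflict {n : ℕ} (A B : Set (Fin (n + 1))) : Prop :=
  ¬ (0 ∈ A ↔ 0 ∈ B) ∧ ∀ k : Fin n, k.succ ∈ A ↔ k.succ ∈ B

namespace NWFormula

variable {AP : Type*}

/-- In the suffix from `i`, the formula `neg (prev top)` singles out `i`: the domain is an interval,
so any later position has a predecessor in it. -/
theorem sat_disagree_subFrom (a : AP) (w : NestedWord AP) {i j : ℕ} (hi : i ∈ w.dom)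
    (hj : j ∈ w.dom) (hij : i ≤ j) :
    (disagree a).Sat (w.subFrom i) j ↔ ¬ (a ∈ w.label i ↔ a ∈ w.label j) := by
  have key : (once (and (neg (prev top)) (atom a))).Sat (w.subFrom i) j ↔ a ∈ w.label i := by
    simp only [sat_once, sat_and, Sat, NestedWord.subFrom, NestedWord.restrict, Set.mem_inter_iff,
      Set.mem_Ici]
    constructor
    · rintro ⟨-, p, ⟨hp, hip⟩, hpj, hfirst, ha⟩
      rcases hip.eq_or_lt with rfl | hlt
      · exact ha
      · refine absurd ⟨p - 1, ⟨?_, by omega⟩, by omega, trivial⟩ hfirst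
        exact w.ordConnected.out hi hp ⟨by omega, by omega⟩
    · intro ha
      refine ⟨⟨hj, hij⟩, i, ⟨hi, le_rfl⟩, hij, ?_, ha⟩
      rintro ⟨q, ⟨-, hq⟩, hqi, -⟩
      omega
  simp only [disagree, Sat, sat_and, key]
  change (a ∈ w.label j ∧ _) ∨ (¬ a ∈ w.label j ∧ _) ↔ _
  tauto

theorem sat_conflict_subFrom {n : ℕ} (w : NestedWord (Fin (n + 1))) {i : ℕ} (hi : i ∈ w.dom) :
    (conflict n).Sat (w.subFrom i) i ↔
      ∃ j ∈ w.dom, i ≤ j ∧ LabelConflict (w.label i) (w.label j) := by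
  have hdom : ∀ j, j ∈ (w.subFrom i).dom ↔ j ∈ w.dom ∧ i ≤ j := fun j => Iff.rfl
  simp only [conflict, sat_eventually, hdom, sat_and]
  constructor
  · rintro ⟨-, j, ⟨hj, -⟩, hij, h0, hk⟩
    refine ⟨j, hj, hij, (sat_disagree_subFrom _ w hi hj hij).1 h0, fun k => ?_⟩
    by_contra hne
    exact hk ((sat_bigOr _ _ _).2 ⟨_, List.mem_map.2 ⟨k, List.mem_finRange k, rfl⟩,
      (sat_disagree_subFrom _ w hi hj hij).2 hne⟩)
  · rintro ⟨j, hj, hij, h0, hk⟩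
    refine ⟨⟨hi, le_rfl⟩, j, ⟨hj, hij⟩, hij, (sat_disagree_subFrom _ w hi hj hij).2 h0,
      fun hor => ?_⟩
    obtain ⟨φ, hφ, hsat⟩ := (sat_bigOr _ _ _).1 hor
    obtain ⟨k, -, rfl⟩ := List.mem_map.1 hφ
    exact (sat_disagree_subFrom _ w hi hj hij).1 hsat (hk k)

/-- The guard `neg (nextM top)` rules out the matched case of `within`, leaving only suffixes. -/
theorem sat_noConflict {n : ℕ} (w : NestedWord (Fin (n + 1))) {i : ℕ} (hi : i ∈ w.dom) :
    (noConflict n).Sat w i ↔ ¬ ∃ p ∈ w.dom, i ≤ p ∧ ¬ w.IsMatchedCall p ∧ w.call p ∧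
      ∃ j ∈ w.dom, p ≤ j ∧ LabelConflict (w.label p) (w.label j) := by
  simp only [noConflict, Sat, sat_eventually, sat_and, hi, true_and, and_true]
  refine not_congr (exists_congr fun p => and_congr_right fun hp => and_congr_right fun _ => ?_)
  rw [sat_conflict_subFrom w hp]
  constructor
  · rintro ⟨hm, hc, ⟨j, hj, -⟩ | ⟨-, h⟩⟩
    · exact absurd ⟨j, hj⟩ hm
    · exact ⟨hm, hc, h⟩
  · rintro ⟨hm, hc, h⟩
    exact ⟨hm, hc, Or.inr ⟨hm, h⟩⟩

/-! ### An equivalent formula without the within operator -/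

open Classical in
/-- The label of the current position is `A`. -/
noncomputable def labelIs {n : ℕ} (A : Set (Fin n)) : NWFormula (Fin n) :=
  bigAnd ((List.finRange n).map fun k => if k ∈ A then atom k else neg (atom k))

theorem sat_labelIs {n : ℕ} (A : Set (Fin n)) (w : NestedWord (Fin n)) (i : ℕ) :
    (labelIs A).Sat w i ↔ w.label i = A := by
  simp only [labelIs, sat_bigAnd, List.forall_mem_map, List.mem_finRange, true_imp_iff]
  rw [Set.ext_iff]
  refine forall_congr' fun k => ?_
  split_ifs with h <;> simp [Sat, h]

theorem isNWTLPlus_labelIs {n : ℕ} (A : Set (Fin n)) : (labelIs A).IsNWTLPlus := by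
  refine isNWTLPlus_bigAnd fun φ hφ => ?_
  obtain ⟨k, -, rfl⟩ := List.mem_map.1 hφ
  split_ifs <;> trivial

open Classical in
/-- `noConflict n` expressed in `NWTL⁺` by listing all pairs of conflicting labels. -/
noncomputable def noConflictPlus (n : ℕ) : NWFormula (Fin (n + 1)) :=
  neg (eventually (and (neg (nextM top)) (and call (bigOr
    (((Finset.univ : Finset (Set (Fin (n + 1)) × Set (Fin (n + 1)))).filter
      fun P => LabelConflict P.1 P.2).toList.map
        fun P => and (labelIs P.1) (eventually (labelIs P.2)))))))

theorem isNWTLPlus_noConflictPlus (n : ℕ) : (noConflictPlus n).IsNWTLPlus := by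
  refine ⟨trivial, trivial, trivial, isNWTLPlus_bigOr fun φ hφ => ?_⟩
  obtain ⟨P, -, rfl⟩ := List.mem_map.1 hφ
  exact ⟨isNWTLPlus_labelIs _, trivial, isNWTLPlus_labelIs _⟩

theorem noConflict_equivalent (n : ℕ) : (noConflict n).Equivalent (noConflictPlus n) := by
  intro w _ i hi
  rw [sat_noConflict w hi]
  simp only [noConflictPlus, Sat, sat_eventually, sat_and, hi, true_and, and_true, sat_bigOr]
  refine not_congr (exists_congr fun p => and_congr_right fun hp => and_congr_right fun _ =>
    and_congr Iff.rfl (and_congr_right fun _ => ?_))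
  constructor
  · rintro ⟨j, hj, hpj, h⟩
    refine ⟨_, List.mem_map.2 ⟨(w.label p, w.label j), by simpa using h, rfl⟩, ?_⟩
    exact (sat_and _ _ _ _).2 ⟨(sat_labelIs _ _ _).2 rfl,
      (sat_eventually _ _ _).2 ⟨hp, j, hj, hpj, (sat_labelIs _ _ _).2 rfl⟩⟩
  · rintro ⟨φ, hφ, hsat⟩
    obtain ⟨P, hP, rfl⟩ := List.mem_map.1 hφ
    have hP' : LabelConflict P.1 P.2 := by simpa using hP
    obtain ⟨h1, h2⟩ := (sat_and _ _ _ _).1 hsat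
    obtain ⟨-, j, hj, hpj, h2⟩ := (sat_eventually _ _ _).1 h2
    rw [sat_labelIs] at h1 h2
    exact ⟨j, hj, hpj, by rwa [h1, h2]⟩

/-! ### Subformula occurrences, counted by the size -/

/-- The subformulas of a formula, with repetitions. -/
def subformulas : NWFormula AP → List (NWFormula AP)
  | top => [top]
  | atom a => [atom a]
  | call => [call]
  | ret => [ret]
  | neg φ => neg φ :: φ.subformulas
  | or φ ψ => or φ ψ :: (φ.subformulas ++ ψ.subformulas)
  | next φ => next φ :: φ.subformulas
  | nextM φ => nextM φ :: φ.subformulas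
  | prev φ => prev φ :: φ.subformulas
  | prevM φ => prevM φ :: φ.subformulas
  | untl κ φ ψ => untl κ φ ψ :: (φ.subformulas ++ ψ.subformulas)
  | since κ φ ψ => since κ φ ψ :: (φ.subformulas ++ ψ.subformulas)
  | within φ => within φ :: φ.subformulas

theorem length_subformulas (φ : NWFormula AP) : φ.subformulas.length = φ.size := by
  induction φ <;> simp_all [subformulas, size]

theorem self_mem_subformulas (φ : NWFormula AP) : φ ∈ φ.subformulas := by
  cases φ <;> simp [subformulas]

end NWFormula

/-! ### Words in which every position is a pending call -/

/-- The nested `ω`-word with the given labels in which all positions are pending calls. -/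
def pendingWord {AP : Type*} (L : ℕ → Set AP) : NestedWord AP where
  dom := Set.Ici 1
  ordConnected := Set.ordConnected_Ici
  label := L
  M _ _ := False
  call i := 1 ≤ i
  ret _ := False
  call_mem _ h := h
  ret_mem _ h := h.elim
  M_call _ _ h := h.elim
  M_ret _ _ h := h.elim
  M_lt _ _ h := h.elim
  M_right_unique _ _ _ h := h.elim
  M_left_unique _ _ _ h := h.elim
  nested _ _ _ _ h := h.elim

theorem mem_dom_pendingWord {AP : Type*} (L : ℕ → Set AP) (i : ℕ) :
    i ∈ (pendingWord L).dom ↔ 1 ≤ i := Iff.rfl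

theorem isOmega_pendingWord {AP : Type*} (L : ℕ → Set AP) : (pendingWord L).IsOmega := rfl

/-- Summary paths and linear paths, which on pending calls move to the successor. -/
def PathKind.IsStepwise : PathKind → Prop
  | .summary => True
  | .linear => True
  | .callPath => False
  | .abstr => False

theorem pathStep_pendingWord_of_isStepwise {AP : Type*} (L : ℕ → Set AP) {κ : PathKind}
    (hκ : κ.IsStepwise) (j a b : ℕ) : PathStep (pendingWord L) κ j a b ↔ b = a + 1 := by
  cases κ with
  | summary => simp [PathStep, pendingWord]
  | linear => rfl
  | callPath => exact hκ.elim
  | abstr => exact hκ.elim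

/-- A call-path step needs a matched call, and an abstract step from an unmatched position needs a
non-call. -/
theorem not_pathStep_pendingWord {AP : Type*} (L : ℕ → Set AP) {κ : PathKind}
    (hκ : ¬ κ.IsStepwise) (j a : ℕ) (ha : a ∈ (pendingWord L).dom) (b : ℕ) :
    ¬ PathStep (pendingWord L) κ j a b := by
  intro h
  cases κ with
  | summary => exact hκ trivial
  | linear => exact hκ trivial
  | callPath => exact h.1.2.elim fun _ h => h.1
  | abstr => exact h.elim id fun h => h.1 ha

/-! ### Gluing words of pending calls -/

/-- The labels `L₁` up to position `N`, followed by the labels `L₂`. -/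
def glue {AP : Type*} (N : ℕ) (L₁ L₂ : ℕ → Set AP) (i : ℕ) : Set AP :=
  if i ≤ N then L₁ i else L₂ i

namespace NWFormula

variable {AP : Type*}

/-- From `N` on, an until looks only at positions governed by `L₂`. Before `N`, a witness beyond `N`
makes the until true at `N` as well, and there `hN` trades `L₂` for `L₁`. -/
theorem sat_untl_glue {L₁ L₂ : ℕ → Set AP} {N : ℕ} (κ : PathKind) {φ ψ : NWFormula AP}
    (hN : (untl κ φ ψ).Sat (pendingWord L₁) N ↔ (untl κ φ ψ).Sat (pendingWord L₂) N)
    (hφ : ∀ i, 1 ≤ i →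
      (i ≤ N → (φ.Sat (pendingWord (glue N L₁ L₂)) i ↔ φ.Sat (pendingWord L₁) i)) ∧
      (N ≤ i → (φ.Sat (pendingWord (glue N L₁ L₂)) i ↔ φ.Sat (pendingWord L₂) i)))
    (hψ : ∀ i, 1 ≤ i →
      (i ≤ N → (ψ.Sat (pendingWord (glue N L₁ L₂)) i ↔ ψ.Sat (pendingWord L₁) i)) ∧
      (N ≤ i → (ψ.Sat (pendingWord (glue N L₁ L₂)) i ↔ ψ.Sat (pendingWord L₂) i)))
    (i : ℕ) (hi : 1 ≤ i) :
    (i ≤ N → ((untl κ φ ψ).Sat (pendingWord (glue N L₁ L₂)) i ↔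
      (untl κ φ ψ).Sat (pendingWord L₁) i)) ∧
    (N ≤ i → ((untl κ φ ψ).Sat (pendingWord (glue N L₁ L₂)) i ↔
      (untl κ φ ψ).Sat (pendingWord L₂) i)) := by
  by_cases hκ : κ.IsStepwise
  · simp only [fun L : ℕ → Set AP =>
      sat_untl_of_step_iff_succ (pathStep_pendingWord_of_isStepwise L hκ), mem_dom_pendingWord]
      at hN ⊢
    have after : ∀ i, 1 ≤ i → N ≤ i →
        ((∃ j, 1 ≤ j ∧ i ≤ j ∧ ψ.Sat (pendingWord (glue N L₁ L₂)) j ∧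
          ∀ p, i ≤ p → p < j → φ.Sat (pendingWord (glue N L₁ L₂)) p) ↔
        ∃ j, 1 ≤ j ∧ i ≤ j ∧ ψ.Sat (pendingWord L₂) j ∧
          ∀ p, i ≤ p → p < j → φ.Sat (pendingWord L₂) p) := by
      intro i hi hNi
      refine exists_congr fun j => and_congr_right fun hj => and_congr_right fun hij =>
        and_congr ((hψ j hj).2 (by omega)) (forall_congr' fun p => forall_congr' fun h => ?_)
      rw [(hφ p (by omega)).2 (by omega)]
    refine ⟨fun hiN => and_congr_right fun _ => ?_, fun hNi => and_congr_right fun _ => after i hi hNi⟩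
    have hN1 : 1 ≤ N := by omega
    simp only [hN1, true_and] at hN
    -- At `N` itself the glued word agrees with `L₁` too; this exchanges a witness beyond `N` for
    -- another one.
    have hglue := (after N hN1 le_rfl).trans hN.symm
    constructor
    · rintro ⟨j, hj, hij, hj', hp⟩
      rcases le_total j N with hjN | hjN
      · exact ⟨j, hj, hij, ((hψ j hj).1 hjN).1 hj', fun p h1 h2 =>
          ((hφ p (by omega)).1 (by omega)).1 (hp p h1 h2)⟩
      · obtain ⟨j', hj1, hNj', hj2, hp2⟩ :=
          hglue.1 ⟨j, hj, hjN, hj', fun p h1 h2 => hp p (by omega) h2⟩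
        refine ⟨j', hj1, by omega, hj2, fun p h1 h2 => ?_⟩
        rcases lt_or_ge p N with h | h
        · exact ((hφ p (by omega)).1 (by omega)).1 (hp p h1 (by omega))
        · exact hp2 p h h2
    · rintro ⟨j, hj, hij, hj', hp⟩
      rcases le_total j N with hjN | hjN
      · exact ⟨j, hj, hij, ((hψ j hj).1 hjN).2 hj', fun p h1 h2 =>
          ((hφ p (by omega)).1 (by omega)).2 (hp p h1 h2)⟩
      · obtain ⟨j', hj1, hNj', hj2, hp2⟩ :=
          hglue.2 ⟨j, hj, hjN, hj', fun p h1 h2 => hp p (by omega) h2⟩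
        refine ⟨j', hj1, by omega, hj2, fun p h1 h2 => ?_⟩
        rcases lt_or_ge p N with h | h
        · exact ((hφ p (by omega)).1 (by omega)).2 (hp p h1 (by omega))
        · exact hp2 p h h2
  · simp only [fun L : ℕ → Set AP => sat_untl_of_not_step (not_pathStep_pendingWord L hκ),
      mem_dom_pendingWord]
    exact ⟨fun h => and_congr_right fun _ => (hψ i hi).1 h,
      fun h => and_congr_right fun _ => (hψ i hi).2 h⟩

/-- Time-reversed version of `sat_untl_glue`: up to `N` only `L₁` matters, and a witness before `N`
is exchanged at `N`. -/
theorem sat_since_glue {L₁ L₂ : ℕ → Set AP} {N : ℕ} (hN1 : 1 ≤ N) (κ : PathKind)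
    {φ ψ : NWFormula AP}
    (hN : (since κ φ ψ).Sat (pendingWord L₁) N ↔ (since κ φ ψ).Sat (pendingWord L₂) N)
    (hφ : ∀ i, 1 ≤ i →
      (i ≤ N → (φ.Sat (pendingWord (glue N L₁ L₂)) i ↔ φ.Sat (pendingWord L₁) i)) ∧
      (N ≤ i → (φ.Sat (pendingWord (glue N L₁ L₂)) i ↔ φ.Sat (pendingWord L₂) i)))
    (hψ : ∀ i, 1 ≤ i →
      (i ≤ N → (ψ.Sat (pendingWord (glue N L₁ L₂)) i ↔ ψ.Sat (pendingWord L₁) i)) ∧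
      (N ≤ i → (ψ.Sat (pendingWord (glue N L₁ L₂)) i ↔ ψ.Sat (pendingWord L₂) i)))
    (i : ℕ) (hi : 1 ≤ i) :
    (i ≤ N → ((since κ φ ψ).Sat (pendingWord (glue N L₁ L₂)) i ↔
      (since κ φ ψ).Sat (pendingWord L₁) i)) ∧
    (N ≤ i → ((since κ φ ψ).Sat (pendingWord (glue N L₁ L₂)) i ↔
      (since κ φ ψ).Sat (pendingWord L₂) i)) := by
  by_cases hκ : κ.IsStepwise
  · simp only [fun L : ℕ → Set AP =>
      sat_since_of_step_iff_succ (pathStep_pendingWord_of_isStepwise L hκ), mem_dom_pendingWord]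
      at hN ⊢
    have before : ∀ i, 1 ≤ i → i ≤ N →
        ((∃ j, 1 ≤ j ∧ j ≤ i ∧ ψ.Sat (pendingWord (glue N L₁ L₂)) j ∧
          ∀ p, j < p → p ≤ i → φ.Sat (pendingWord (glue N L₁ L₂)) p) ↔
        ∃ j, 1 ≤ j ∧ j ≤ i ∧ ψ.Sat (pendingWord L₁) j ∧
          ∀ p, j < p → p ≤ i → φ.Sat (pendingWord L₁) p) := by
      intro i hi hiN
      refine exists_congr fun j => and_congr_right fun hj => and_congr_right fun hij =>
        and_congr ((hψ j hj).1 (by omega))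
          (forall_congr' fun p => forall_congr' fun h => forall_congr' fun h' => ?_)
      rw [(hφ p (by omega)).1 (by omega)]
    refine ⟨fun hiN => and_congr_right fun _ => before i hi hiN,
      fun hNi => and_congr_right fun _ => ?_⟩
    simp only [hN1, true_and] at hN
    have hglue := (before N hN1 le_rfl).trans hN
    constructor
    · rintro ⟨j, hj, hij, hj', hp⟩
      rcases le_total N j with hjN | hjN
      · exact ⟨j, hj, hij, ((hψ j hj).2 hjN).1 hj', fun p h1 h2 =>
          ((hφ p (by omega)).2 (by omega)).1 (hp p h1 h2)⟩
      · obtain ⟨j', hj1, hNj', hj2, hp2⟩ :=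
          hglue.1 ⟨j, hj, hjN, hj', fun p h1 h2 => hp p h1 (by omega)⟩
        refine ⟨j', hj1, by omega, hj2, fun p h1 h2 => ?_⟩
        rcases lt_or_ge N p with h | h
        · exact ((hφ p (by omega)).2 (by omega)).1 (hp p (by omega) h2)
        · exact hp2 p h1 h
    · rintro ⟨j, hj, hij, hj', hp⟩
      rcases le_total N j with hjN | hjN
      · exact ⟨j, hj, hij, ((hψ j hj).2 hjN).2 hj', fun p h1 h2 =>
          ((hφ p (by omega)).2 (by omega)).2 (hp p h1 h2)⟩
      · obtain ⟨j', hj1, hNj', hj2, hp2⟩ :=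
          hglue.2 ⟨j, hj, hjN, hj', fun p h1 h2 => hp p h1 (by omega)⟩
        refine ⟨j', hj1, by omega, hj2, fun p h1 h2 => ?_⟩
        rcases lt_or_ge N p with h | h
        · exact ((hφ p (by omega)).2 (by omega)).2 (hp p (by omega) h2)
        · exact hp2 p h1 h
  · simp only [fun L : ℕ → Set AP => sat_since_of_not_step (not_pathStep_pendingWord L hκ),
      mem_dom_pendingWord]
    exact ⟨fun h => and_congr_right fun _ => (hψ i hi).1 h,
      fun h => and_congr_right fun _ => (hψ i hi).2 h⟩

/-- If the same subformulas of `ψ` hold at position `N` of two words of pending calls, then the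
words can be glued at `N` without changing the truth of `ψ`. -/
theorem sat_glue {L₁ L₂ : ℕ → Set AP} {N : ℕ} (hN1 : 1 ≤ N) (ψ : NWFormula AP)
    (hψ : ψ.IsNWTLPlus)
    (h : ∀ χ ∈ ψ.subformulas, χ.Sat (pendingWord L₁) N ↔ χ.Sat (pendingWord L₂) N) :
    ∀ i, 1 ≤ i →
      (i ≤ N → (ψ.Sat (pendingWord (glue N L₁ L₂)) i ↔ ψ.Sat (pendingWord L₁) i)) ∧
      (N ≤ i → (ψ.Sat (pendingWord (glue N L₁ L₂)) i ↔ ψ.Sat (pendingWord L₂) i)) := by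
  have hself := h _ ψ.self_mem_subformulas
  induction ψ with
  | top => exact fun i _ => ⟨fun _ => Iff.rfl, fun _ => Iff.rfl⟩
  | call => exact fun i _ => ⟨fun _ => Iff.rfl, fun _ => Iff.rfl⟩
  | ret => exact fun i _ => ⟨fun _ => Iff.rfl, fun _ => Iff.rfl⟩
  | atom a =>
    intro i _
    simp only [Sat, pendingWord, glue] at hself ⊢
    refine ⟨fun hi => by rw [if_pos hi], fun hi => ?_⟩
    split_ifs with hiN
    -- At `N` the glued label comes from `L₁`; the atom is itself a subformula, so `L₂` agrees on it
    -- there.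
    · rwa [le_antisymm hiN hi]
    · rfl
  | neg φ ih =>
    have ih := ih hψ (fun χ hχ => h χ (List.mem_cons_of_mem _ hχ))
      (h _ (List.mem_cons_of_mem _ φ.self_mem_subformulas))
    exact fun i hi => ⟨fun hN => not_congr ((ih i hi).1 hN), fun hN => not_congr ((ih i hi).2 hN)⟩
  | or φ χ ihφ ihχ =>
    have hφ : ∀ θ ∈ φ.subformulas, θ ∈ (or φ χ).subformulas := fun θ hθ =>
      List.mem_cons_of_mem _ (List.mem_append_left _ hθ)
    have hχ : ∀ θ ∈ χ.subformulas, θ ∈ (or φ χ).subformulas := fun θ hθ =>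
      List.mem_cons_of_mem _ (List.mem_append_right _ hθ)
    have ihφ := ihφ hψ.1 (fun θ hθ => h θ (hφ θ hθ)) (h _ (hφ _ φ.self_mem_subformulas))
    have ihχ := ihχ hψ.2 (fun θ hθ => h θ (hχ θ hθ)) (h _ (hχ _ χ.self_mem_subformulas))
    exact fun i hi => ⟨fun hN => or_congr ((ihφ i hi).1 hN) ((ihχ i hi).1 hN),
      fun hN => or_congr ((ihφ i hi).2 hN) ((ihχ i hi).2 hN)⟩
  | next φ ih =>
    have ih := ih hψ (fun χ hχ => h χ (List.mem_cons_of_mem _ hχ))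
      (h _ (List.mem_cons_of_mem _ φ.self_mem_subformulas))
    have after : ∀ i, N ≤ i → ((next φ).Sat (pendingWord (glue N L₁ L₂)) i ↔
        (next φ).Sat (pendingWord L₂) i) := fun i hi =>
      and_congr_right fun _ => (ih (i + 1) (by omega)).2 (by omega)
    refine fun i hi => ⟨fun hiN => ?_, after i⟩
    -- At `N` the successor already belongs to `L₂`, so agreement of the two words on the formula
    -- itself is needed.
    rcases hiN.eq_or_lt with rfl | hlt
    · exact (after i le_rfl).trans hself.symm
    · exact and_congr_right fun _ => (ih (i + 1) (by omega)).1 hlt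
  | prev φ ih =>
    have ih := ih hψ (fun χ hχ => h χ (List.mem_cons_of_mem _ hχ))
      (h _ (List.mem_cons_of_mem _ φ.self_mem_subformulas))
    have before : ∀ i, i ≤ N → ((prev φ).Sat (pendingWord (glue N L₁ L₂)) i ↔
        (prev φ).Sat (pendingWord L₁) i) := fun i hi =>
      exists_congr fun j => and_congr_right fun hj => and_congr_right fun hji =>
        (ih j hj).1 (by omega)
    refine fun i hi => ⟨before i, fun hNi => ?_⟩
    rcases hNi.eq_or_lt with rfl | hlt
    · exact (before N le_rfl).trans hself
    · exact exists_congr fun j => and_congr_right fun hj => and_congr_right fun hji =>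
        (ih j hj).2 (by omega)
  | nextM φ =>
    exact fun i _ => ⟨fun _ => exists_congr fun _ => and_congr_right False.elim,
      fun _ => exists_congr fun _ => and_congr_right False.elim⟩
  | prevM φ =>
    exact fun i _ => ⟨fun _ => exists_congr fun _ => and_congr_right False.elim,
      fun _ => exists_congr fun _ => and_congr_right False.elim⟩
  | untl κ φ χ ihφ ihχ =>
    have hφ : ∀ θ ∈ φ.subformulas, θ ∈ (untl κ φ χ).subformulas := fun θ hθ =>
      List.mem_cons_of_mem _ (List.mem_append_left _ hθ)
    have hχ : ∀ θ ∈ χ.subformulas, θ ∈ (untl κ φ χ).subformulas := fun θ hθ =>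
      List.mem_cons_of_mem _ (List.mem_append_right _ hθ)
    exact sat_untl_glue κ hself
      (ihφ hψ.1 (fun θ hθ => h θ (hφ θ hθ)) (h _ (hφ _ φ.self_mem_subformulas)))
      (ihχ hψ.2 (fun θ hθ => h θ (hχ θ hθ)) (h _ (hχ _ χ.self_mem_subformulas)))
  | since κ φ χ ihφ ihχ =>
    have hφ : ∀ θ ∈ φ.subformulas, θ ∈ (since κ φ χ).subformulas := fun θ hθ =>
      List.mem_cons_of_mem _ (List.mem_append_left _ hθ)
    have hχ : ∀ θ ∈ χ.subformulas, θ ∈ (since κ φ χ).subformulas := fun θ hθ =>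
      List.mem_cons_of_mem _ (List.mem_append_right _ hθ)
    exact sat_since_glue hN1 κ hself
      (ihφ hψ.1 (fun θ hθ => h θ (hφ θ hθ)) (h _ (hφ _ φ.self_mem_subformulas)))
      (ihχ hψ.2 (fun θ hθ => h θ (hχ θ hθ)) (h _ (hχ _ χ.self_mem_subformulas)))
  | within φ => exact hψ.elim

theorem sat_noConflict_pendingWord {n : ℕ} (L : ℕ → Set (Fin (n + 1))) :
    (noConflict n).Sat (pendingWord L) 1 ↔
      ∀ p j, 1 ≤ p → p ≤ j → ¬ LabelConflict (L p) (L j) := by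
  rw [sat_noConflict _ ((mem_dom_pendingWord L 1).2 le_rfl)]
  constructor
  · intro h p j hp hpj hc
    exact h ⟨p, hp, hp, fun h => h.elim fun _ h => h, hp, j, hp.trans hpj, hpj, hc⟩
  · rintro h ⟨p, hp, -, -, -, j, -, hpj, hc⟩
    exact h p j hp hpj hc

end NWFormula

/-! ### Words encoding Boolean tables -/

/-- At position `p`, the propositions `a₁, …, aₙ` are the binary digits of `p` modulo `2 ^ n`, and
`a₀` is the value of `f` at `p` modulo `2 ^ n`. -/
def tableLabel {n : ℕ} (f : Fin (2 ^ n) → Bool) (p : ℕ) : Set (Fin (n + 1)) :=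
  {a | Fin.cases (motive := fun _ => Prop)
    (f ⟨p % 2 ^ n, Nat.mod_lt _ (by positivity)⟩ = true) (fun k => p.testBit k = true) a}

theorem zero_mem_tableLabel {n : ℕ} (f : Fin (2 ^ n) → Bool) (p : ℕ) :
    0 ∈ tableLabel f p ↔ f ⟨p % 2 ^ n, Nat.mod_lt _ (by positivity)⟩ = true := Iff.rfl

theorem succ_mem_tableLabel {n : ℕ} (f : Fin (2 ^ n) → Bool) (p : ℕ) (k : Fin n) :
    k.succ ∈ tableLabel f p ↔ p.testBit k = true := Iff.rfl

/-- The `n` lowest binary digits determine a number modulo `2 ^ n`, whichever tables are used. -/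
theorem forall_succ_mem_tableLabel_iff {n : ℕ} (f g : Fin (2 ^ n) → Bool) (p q : ℕ) :
    (∀ k : Fin n, k.succ ∈ tableLabel f p ↔ k.succ ∈ tableLabel g q) ↔
      p % 2 ^ n = q % 2 ^ n := by
  simp only [succ_mem_tableLabel, ← Bool.eq_iff_iff]
  constructor
  · intro h
    refine Nat.eq_of_testBit_eq fun k => ?_
    rw [Nat.testBit_mod_two_pow, Nat.testBit_mod_two_pow]
    by_cases hk : k < n
    · rw [h ⟨k, hk⟩]
    · simp [hk]
  · intro h k
    have := congrArg (fun m => m.testBit k) h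
    simpa [Nat.testBit_mod_two_pow] using this

theorem not_labelConflict_tableLabel {n : ℕ} (f : Fin (2 ^ n) → Bool) (p q : ℕ) :
    ¬ LabelConflict (tableLabel f p) (tableLabel f q) := by
  rintro ⟨h0, hk⟩
  have hpq := (forall_succ_mem_tableLabel_iff f f p q).1 hk
  simp only [zero_mem_tableLabel, hpq, not_true] at h0

/-- Gluing the words of two different tables after one period creates a conflict. -/
theorem exists_labelConflict_glue {n : ℕ} {f g : Fin (2 ^ n) → Bool} (hfg : f ≠ g) :
    ∃ p q, 1 ≤ p ∧ p ≤ q ∧ LabelConflict (glue (2 ^ n) (tableLabel f) (tableLabel g) p)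
      (glue (2 ^ n) (tableLabel f) (tableLabel g) q) := by
  obtain ⟨x, hx⟩ := Function.ne_iff.1 hfg
  have hpos : 0 < 2 ^ n := by positivity
  obtain ⟨p, hp1, hpN, hpx⟩ : ∃ p : ℕ, 1 ≤ p ∧ p ≤ 2 ^ n ∧ p % 2 ^ n = (x : ℕ) := by
    rcases Nat.eq_zero_or_pos (x : ℕ) with h | h
    -- Positions start at 1, so address 0 is read at the end of the first period.
    · exact ⟨2 ^ n, hpos, le_rfl, by simp [h]⟩
    · exact ⟨x, h, x.2.le, Nat.mod_eq_of_lt x.2⟩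
  have hqx : (p + 2 ^ n) % 2 ^ n = (x : ℕ) := by rw [Nat.add_mod_right, hpx]
  -- One period later lies beyond the gluing point: same address `x`, but `a₀` is now read from `g`.
  refine ⟨p, p + 2 ^ n, hp1, by omega, ?_⟩
  rw [glue, glue, if_pos hpN, if_neg (by omega)]
  refine ⟨?_, (forall_succ_mem_tableLabel_iff _ _ _ _).2 (by rw [hpx, hqx])⟩
  simp only [zero_mem_tableLabel, hpx, hqx, Fin.eta]
  rwa [← Bool.eq_iff_iff]

/-! ### The counting argument -/

namespace NWFormula

theorem two_pow_le_size_of_sameOmegaModels {n : ℕ} {ψ : NWFormula (Fin (n + 1))}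
    (hψ : ψ.IsNWTLPlus) (h : (noConflict n).SameOmegaModels ψ) : 2 ^ n ≤ ψ.size := by
  classical
  -- The truth values at the gluing position, indexed by subformula occurrences so that there are `2
  -- ^ ψ.size` possible types.
  let type (f : Fin (2 ^ n) → Bool) (m : Fin ψ.size) : Bool :=
    decide ((ψ.subformulas[m]'(by rw [length_subformulas]; exact m.2)).Sat
      (pendingWord (tableLabel f)) (2 ^ n))
  have hinj : Function.Injective type := by
    intro f g hfg
    by_contra hne
    obtain ⟨p, q, hp, hpq, hc⟩ := exists_labelConflict_glue hne
    have hsat : ψ.Sat (pendingWord (tableLabel f)) 1 := by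
      rw [← h _ (isOmega_pendingWord _), sat_noConflict_pendingWord]
      exact fun p j _ _ => not_labelConflict_tableLabel f p j
    have hglue : ψ.Sat (pendingWord (glue (2 ^ n) (tableLabel f) (tableLabel g))) 1 := by
      refine ((sat_glue Nat.one_le_two_pow ψ hψ (fun χ hχ => ?_) 1 le_rfl).1
        Nat.one_le_two_pow).2 hsat
      obtain ⟨m, hm, rfl⟩ := List.getElem_of_mem hχ
      have := congrFun hfg ⟨m, by rwa [length_subformulas] at hm⟩
      simpa [type] using this
    rw [← h _ (isOmega_pendingWord _), sat_noConflict_pendingWord] at hglue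
    exact hglue p q hp hpq hc
  have hcard := Fintype.card_le_of_injective type hinj
  simp only [Fintype.card_fun, Fintype.card_fin, Fintype.card_bool] at hcard
  exact (Nat.pow_le_pow_iff_right (by norm_num)).1 hcard

end NWFormula

theorem theorem5p6 :
    ∃ φ : (n : ℕ) → NWFormula (Fin (n + 1)),
      (∃ C : ℕ, ∀ n ≥ 1, (φ n).size ≤ C * n) ∧
      (∀ n ≥ 1, ∃ ψ : NWFormula (Fin (n + 1)), ψ.IsNWTLPlus ∧ (φ n).Equivalent ψ) ∧
      (∃ c : ℝ, 0 < c ∧ ∃ n₀ : ℕ, ∀ n ≥ n₀, ∀ ψ : NWFormula (Fin (n + 1)),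
        ψ.IsNWTLPlus → (φ n).SameOmegaModels ψ → (2 : ℝ) ^ (c * (n : ℝ)) ≤ (ψ.size : ℝ)) := by
  refine ⟨NWFormula.noConflict, ⟨100, fun n hn => NWFormula.size_noConflict_le hn⟩,
    fun n _ => ⟨NWFormula.noConflictPlus n, NWFormula.isNWTLPlus_noConflictPlus n,
      NWFormula.noConflict_equivalent n⟩, 1, one_pos, 0, fun n _ ψ hψ h => ?_⟩
  rw [one_mul, Real.rpow_natCast]
  exact_mod_cast NWFormula.two_pow_le_size_of_sameOmegaModels hψ h
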